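/- Let $\mathbf{S}=\mathbf{R}/\mathbf{Z}$. Let $\widehat{\mathrm{PC}^{\bowtie}}(\mathbf{S})$ be the group of permutations of $\mathbf{S}$ that are continuous outside a finite subset, let $\mathfrak{S}_{\mathrm{fin}}(\mathbf{S})$ be its normal subgroup of finitely supported permutations, and let $\pi:\widehat{\mathrm{PC}^{\bowtie}}(\mathbf{S})\to \mathrm{PC}^{\bowtie}(\mathbf{S})=\widehat{\mathrm{PC}^{\bowtie}}(\mathbf{S})/\mathfrak{S}_{\mathrm{fin}}(\mathbf{S})$ be the quotient homomorphism. A subgroup $\Gamma$ of $\mathrm{PC}^{\bowtie}(\mathbf{S})$ is realizable if there is a subgroup $\tilde\Gamma$ of $\widehat{\mathrm{PC}^{\bowtie}}(\mathbf{S})$ such that $\pi$ restricts to a bijection $\tilde\Gamma\to\Gamma$. Rotations are the (classes of the) maps $x\mapsto x+t$, $t\in\mathbf{S}$. For an interval $I\subset\mathbf{S}$ of length $\rho\in\,]0,1[$, the group of partial rotations of $I$ is the group $\mathbf{R}/\rho\mathbf{Z}$ acting by rotations on the circle obtained by identifying the endpoints of $\bar I$, and trivially outside $I$. The $\mathbf{Q}$-rank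 of an abelian group $A$ is $\dim_{\mathbf{Q}}(A\otimes_{\mathbf{Z}}\mathbf{Q})$. An element $f\in\mathrm{PC}^{\bowtie}(\mathbf{S})$ is a 132-flip if $f^2=1$ and there are three consecutive intervals $I_1,I_2,I_3$ of nonzero length, partitioning $\mathbf{S}$ up to finitely many points, such that (up to finitely many points) $f$ has no singularity in the interior of each $I_j$, $f(I_1)=I_1$, $f(I_2)=I_3$, $f(I_3)=I_2$, and $f$ is orientation-reversing on $I_1$ and orientation-preserving on $I_2$ and on $I_3$. It is a triple flip if $f^2=1$ and there are three such consecutive intervals, each of which is mapped by $f$ onto itself (up to finitely many points) in an orientation-reversing way. **Theorem.** Let $\Gamma$ be a subgroup of $\mathrm{PC}^{\bowtie}(\mathbf{S})$. Suppose that 1. $\Gamma$ includes a subgroup $\Lambda$ of rotations that either has $\mathbf{Q}$-rank $\ge 2$, or is infinitely generated and has $\mathbf{Q}$-rank $1$; 2. for some interval $I$ of length in $]0,1[$, $\Gamma$ includes a dense subgroup of the group $\simeq\mathbf{R}/\rho\mathbf{Z}$ of partial rotations of $I$; 3. $\Gamma$ contains a 132-flip or a triple flip. Then $\Gamma$ is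 not realizable. -/

import Mathlib

open Set Filter Topology
open scoped TensorProduct

/-- The circle `ℝ / ℤ`. -/
abbrev Circ : Type := AddCircle (1 : ℝ)

/-- Projection from the line to the circle is an open quotient map. -/
theorem circ_coe_isOpenQuotientMap : IsOpenQuotientMap ((↑) : ℝ → Circ) :=
  QuotientAddGroup.isOpenQuotientMap_mk

/-- An injective continuous map defined near a point of the circle is open at that point. -/
theorem circ_image_mem_nhds (g : Equiv.Perm Circ) (x : Circ)
    (hc : ∀ᶠ y in 𝓝 x, ContinuousAt g y) (U : Set Circ) (hU : U ∈ 𝓝 x) :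
    g '' U ∈ 𝓝 (g x) := by
  obtain ⟨r, rfl⟩ := circ_coe_isOpenQuotientMap.surjective x
  obtain ⟨s, hs⟩ := circ_coe_isOpenQuotientMap.surjective (g r)
  set L : Circ → ℝ := fun y => (AddCircle.equivIco 1 (s - 1 / 2) y : ℝ) with hL
  have hLc : ∀ y : Circ, ((L y : ℝ) : Circ) = y := fun y => AddCircle.coe_equivIco
  have hne : g r ≠ ((s - 1 / 2 : ℝ) : Circ) := by
    rw [← hs]
    intro h
    have h1 := (AddCircle.coe_eq_coe_iff_of_mem_Ico (p := (1 : ℝ)) (a := s - 1 / 2)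
      (x := s) (y := s - 1 / 2) ⟨by linarith, by linarith⟩ ⟨by linarith, by linarith⟩).1 h
    linarith
  have hcoe : Continuous ((↑) : ℝ → Circ) := circ_coe_isOpenQuotientMap.continuous
  have e1 : ∀ᶠ t in 𝓝 r, ContinuousAt g ((t : ℝ) : Circ) := hcoe.continuousAt.eventually hc
  have e2 : ∀ᶠ t in 𝓝 r, g ((t : ℝ) : Circ) ≠ ((s - 1 / 2 : ℝ) : Circ) := by
    have h1 : ContinuousAt (fun t : ℝ => g (t : Circ)) r :=
      ContinuousAt.comp (f := ((↑) : ℝ → Circ)) hc.self_of_nhds hcoe.continuousAt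
    exact h1.eventually_ne hne
  have e3 : ∀ᶠ t in 𝓝 r, ((t : ℝ) : Circ) ∈ U := hcoe.continuousAt.eventually hU
  obtain ⟨d, hd, hball⟩ := Metric.eventually_nhds_iff.1 (e1.and (e2.and e3))
  set e : ℝ := min (d / 2) (1 / 4) with he
  have he0 : 0 < e := lt_min (by linarith) (by norm_num)
  have hed : e < d := lt_of_le_of_lt (min_le_left _ _) (by linarith)
  have he4 : e ≤ 1 / 4 := min_le_right _ _
  have hin : ∀ t ∈ Icc (r - e) (r + e), ContinuousAt g ((t : ℝ) : Circ) ∧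
      g ((t : ℝ) : Circ) ≠ ((s - 1 / 2 : ℝ) : Circ) ∧ ((t : ℝ) : Circ) ∈ U := by
    intro t ht
    apply hball
    rw [Real.dist_eq, abs_lt]
    constructor <;> linarith [ht.1, ht.2]
  set h : ℝ → ℝ := fun t => L (g (t : Circ)) with hh
  have hcont : ContinuousOn h (Icc (r - e) (r + e)) := by
    intro t ht
    obtain ⟨h1, h2, -⟩ := hin t ht
    have h3 : ContinuousAt (fun t : ℝ => g (t : Circ)) t :=
      ContinuousAt.comp (f := ((↑) : ℝ → Circ)) h1 hcoe.continuousAt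
    have h4 : ContinuousAt L (g (t : Circ)) :=
      continuous_subtype_val.continuousAt.comp (AddCircle.continuousAt_equivIco 1 (s - 1 / 2) h2)
    exact (ContinuousAt.comp (f := fun t : ℝ => g (t : Circ)) h4 h3).continuousWithinAt
  have hinj : InjOn h (Icc (r - e) (r + e)) := by
    intro t ht u hu htu
    have h1 : g (t : Circ) = g (u : Circ) := by
      rw [← hLc (g (t : Circ)), ← hLc (g (u : Circ))]
      exact congrArg _ htu
    exact (AddCircle.coe_eq_coe_iff_of_mem_Ico (p := (1 : ℝ)) (a := r - e)
      ⟨ht.1, by linarith [ht.2]⟩ ⟨hu.1, by linarith [hu.2]⟩).1 (g.injective h1)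
  have hmem : h '' Icc (r - e) (r + e) ∈ 𝓝 (h r) := by
    have hle : r - e ≤ r + e := by linarith
    have hl : r - e ∈ Icc (r - e) (r + e) := ⟨le_refl _, hle⟩
    have hr : r + e ∈ Icc (r - e) (r + e) := ⟨hle, le_refl _⟩
    have hm : r ∈ Icc (r - e) (r + e) := ⟨by linarith, by linarith⟩
    rcases hcont.strictMonoOn_of_injOn_Icc' hle hinj with hmono | hanti
    · exact mem_of_superset (Icc_mem_nhds (hmono hl hm (by linarith))
        (hmono hm hr (by linarith))) (intermediate_value_Icc hle hcont)
    · exact mem_of_superset (Icc_mem_nhds (hanti hm hr (by linarith))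
        (hanti hl hm (by linarith))) (intermediate_value_Icc' hle hcont)
  have himg := circ_coe_isOpenQuotientMap.isOpenMap.image_mem_nhds hmem
  have hgr : ((h r : ℝ) : Circ) = g (r : Circ) := hLc _
  rw [hgr] at himg
  refine mem_of_superset himg ?_
  rintro _ ⟨_, ⟨t, ht, rfl⟩, rfl⟩
  exact ⟨t, (hin t ht).2.2, (hLc _).symm⟩

/-- The inverse of a permutation with finitely many discontinuities has finitely many
discontinuities. -/
theorem circ_inv_discontinuities_finite (g : Equiv.Perm Circ)
    (hg : {x | ¬ ContinuousAt g x}.Finite) : {x | ¬ ContinuousAt (g⁻¹ : Equiv.Perm Circ) x}.Finite := by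
  refine (hg.image g).subset ?_
  intro y hy
  by_contra hcon
  apply hy
  obtain ⟨x, rfl⟩ := g.surjective y
  have hx : x ∈ {x | ¬ ContinuousAt g x}ᶜ := fun h => hcon ⟨x, h, rfl⟩
  have hc : ∀ᶠ y in 𝓝 x, ContinuousAt g y := by
    filter_upwards [hg.isClosed.isOpen_compl.mem_nhds hx] with y hy
    simpa using hy
  intro V hV
  have hV' : V ∈ 𝓝 x := by simpa using hV
  rw [mem_map]
  refine mem_of_superset (circ_image_mem_nhds g x hc V hV') ?_
  rintro _ ⟨z, hz, rfl⟩
  simpa using hz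

/-- The group of permutations of the circle that are continuous outside a finite subset. -/
def PCHat : Subgroup (Equiv.Perm Circ) where
  carrier := {g | {x | ¬ ContinuousAt g x}.Finite}
  one_mem' := by
    have : {x : Circ | ¬ ContinuousAt (1 : Equiv.Perm Circ) x} = ∅ := by
      ext x
      simpa using (continuousAt_id : ContinuousAt (id : Circ → Circ) x)
    change Set.Finite _
    rw [this]
    exact finite_empty
  mul_mem' := by
    intro f g hf hg
    refine (hg.union (hf.preimage (g.injective.injOn))).subset ?_
    intro x hx
    by_contra hcon
    simp only [mem_union, mem_preimage, mem_ofPred_eq, not_or, not_not] at hcon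
    exact hx (ContinuousAt.comp (f := g) hcon.2 hcon.1)
  inv_mem' := by
    intro g hg
    exact circ_inv_discontinuities_finite g hg

/-- The group of finitely supported permutations of the circle. -/
def FinPerm : Subgroup (Equiv.Perm Circ) where
  carrier := {g | {x | g x ≠ x}.Finite}
  one_mem' := by simp
  mul_mem' := by
    intro f g hf hg
    refine (hg.union hf).subset ?_
    intro x hx
    by_contra hcon
    simp only [mem_union, mem_ofPred_eq, not_or, not_not] at hcon
    apply hx
    rw [Equiv.Perm.mul_apply, hcon.1, hcon.2]
  inv_mem' := by
    intro g hg
    refine Set.Finite.subset hg ?_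
    intro x hx h
    exact hx (by rw [Equiv.Perm.inv_eq_iff_eq]; exact h.symm)

instance FinPerm.normal : FinPerm.Normal where
  conj_mem := by
    intro n hn g
    refine (Set.Finite.image g hn).subset ?_
    intro x hx
    refine ⟨g⁻¹ x, ?_, by simp⟩
    intro h
    apply hx
    simp only [Equiv.Perm.mul_apply]
    rw [h]
    simp

/-- Finitely supported permutations are continuous outside a finite subset. -/
theorem FinPerm_le_PCHat : FinPerm ≤ PCHat := by
  intro g hg
  refine Set.Finite.subset hg ?_
  intro x hx h
  apply hx
  have h1 : ∀ᶠ y in 𝓝 x, g y = y := by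
    have hx' : x ∈ {x | g x ≠ x}ᶜ := fun h' => h' h
    filter_upwards [(Set.Finite.isClosed hg).isOpen_compl.mem_nhds hx'] with y hy
    simpa using hy
  exact (continuousAt_id (x := x)).congr (h1.mono fun y hy => hy.symm)

/-- The group of piecewise continuous permutations of the circle modulo finitely supported
permutations. -/
abbrev PC : Type := PCHat ⧸ (FinPerm.subgroupOf PCHat)

/-- The quotient homomorphism from `PCHat` onto `PC`. -/
def PC.proj : PCHat →* PC := QuotientGroup.mk' (FinPerm.subgroupOf PCHat)

/-- A subgroup of `PC` is realizable if some subgroup of `PCHat` is mapped bijectively onto it by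
the quotient homomorphism. -/
def IsRealizable (Γ : Subgroup PC) : Prop :=
  ∃ Λ : Subgroup PCHat, BijOn PC.proj (Λ : Set PCHat) (Γ : Set PC)

/-- The rotation `x ↦ x + t` of the circle. -/
def circRotation (t : Circ) : PC :=
  PC.proj ⟨Equiv.addRight t, by
    have : {x : Circ | ¬ ContinuousAt (Equiv.addRight t) x} = ∅ := by
      ext x
      simpa using (continuous_add_const t).continuousAt
    change Set.Finite _
    rw [this]
    exact finite_empty⟩

/-- The `ℚ`-rank of an abelian group. -/
noncomputable def qRank (A : Type) [AddCommGroup A] : Cardinal :=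
  Module.rank ℚ (ℚ ⊗[ℤ] A)

/-- The injection of the circle `ℝ / ρℤ` into `ℝ / ℤ` which sends the class of `x ∈ [a, a + ρ)` to
the class of `x`: its image is the half-open arc from `a` to `a + ρ`, so `ℝ / ρℤ` is this arc
closed up by identifying its endpoints. -/
noncomputable def arcEmb (a ρ : ℝ) (h₀ : 0 < ρ) (h₁ : ρ < 1) : AddCircle ρ ↪ Circ :=
  haveI : Fact (0 < ρ) := ⟨h₀⟩
  { toFun := fun z => ((AddCircle.equivIco ρ a z : ℝ) : Circ)
    inj' := by
      intro z w hzw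
      have hz := (AddCircle.equivIco ρ a z).2
      have hw := (AddCircle.equivIco ρ a w).2
      have h := (AddCircle.coe_eq_coe_iff_of_mem_Ico (p := (1 : ℝ)) (a := a)
        ⟨hz.1, by linarith [hz.2]⟩ ⟨hw.1, by linarith [hw.2]⟩).1 hzw
      exact (AddCircle.equivIco ρ a).injective (Subtype.ext h) }

/-- The permutation of the circle that is the rotation by `t ∈ ℝ / ρℤ` on the closed-up arc from `a`
to `a + ρ`, and the identity outside this arc. -/
noncomputable def partialRotationPerm (a ρ : ℝ) (h₀ : 0 < ρ) (h₁ : ρ < 1) (t : AddCircle ρ) :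
    Equiv.Perm Circ :=
  Equiv.Perm.viaEmbedding (Equiv.addRight t) (arcEmb a ρ h₀ h₁)

theorem partialRotationPerm_mem (a ρ : ℝ) (h₀ : 0 < ρ) (h₁ : ρ < 1) (t : AddCircle ρ) :
    partialRotationPerm a ρ h₀ h₁ t ∈ PCHat := by
  have : Fact (0 < ρ) := ⟨h₀⟩
  set ι := arcEmb a ρ h₀ h₁ with hι
  set f := partialRotationPerm a ρ h₀ h₁ t with hf
  have hfin : ({((a : ℝ) : Circ), ((a + ρ : ℝ) : Circ), ι ((a : AddCircle ρ) - t)} :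
      Set Circ).Finite := by simp
  refine hfin.subset ?_
  intro y hy
  by_contra hcon
  apply hy
  simp only [mem_insert_iff, mem_singleton_iff, not_or] at hcon
  obtain ⟨hy1, hy2, hy3⟩ := hcon
  have hιcoe : ∀ r ∈ Ico a (a + ρ), ι ((r : ℝ) : AddCircle ρ) = ((r : ℝ) : Circ) := by
    intro r hr
    change ((AddCircle.equivIco ρ a ((r : ℝ) : AddCircle ρ) : ℝ) : Circ) = _
    rw [AddCircle.equivIco_coe_eq hr]
  obtain ⟨r, hr, rfl⟩ : ∃ r ∈ Ico a (a + 1), ((r : ℝ) : Circ) = y :=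
    ⟨_, (AddCircle.equivIco 1 a y).2, AddCircle.coe_equivIco⟩
  rw [← circ_coe_isOpenQuotientMap.continuousAt_comp_iff]
  have hcoe : Continuous ((↑) : ℝ → Circ) := circ_coe_isOpenQuotientMap.continuous
  have hra : a < r := lt_of_le_of_ne hr.1 (fun h => hy1 (by rw [h]))
  rcases lt_trichotomy r (a + ρ) with hlt | heq | hgt
  · have hev : (fun u : ℝ => ((AddCircle.equivIco ρ a (((u : ℝ) : AddCircle ρ) + t) : ℝ) : Circ))
        =ᶠ[𝓝 r] (f ∘ ((↑) : ℝ → Circ)) := by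
      filter_upwards [Ioo_mem_nhds hra hlt] with u hu
      have h1 : f (ι ((u : ℝ) : AddCircle ρ)) = ι (((u : ℝ) : AddCircle ρ) + t) :=
        Equiv.Perm.viaEmbedding_apply (Equiv.addRight t) ι _
      rw [hιcoe u ⟨hu.1.le, hu.2⟩] at h1
      exact h1.symm
    refine ContinuousAt.congr ?_ hev
    have hne : ((r : ℝ) : AddCircle ρ) + t ≠ (a : AddCircle ρ) := by
      intro h
      apply hy3
      rw [← h, add_sub_cancel_right, hιcoe r ⟨hra.le, hlt⟩]
    have h2 : ContinuousAt (fun z : AddCircle ρ => ((AddCircle.equivIco ρ a z : ℝ) : Circ))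
        (((r : ℝ) : AddCircle ρ) + t) :=
      (hcoe.comp continuous_subtype_val).continuousAt.comp
        (AddCircle.continuousAt_equivIco ρ a hne)
    have h3 : ContinuousAt (fun u : ℝ => ((u : ℝ) : AddCircle ρ) + t) r :=
      ((AddCircle.continuous_mk' ρ).add continuous_const).continuousAt
    exact ContinuousAt.comp (f := fun u : ℝ => ((u : ℝ) : AddCircle ρ) + t) h2 h3
  · exact absurd (by rw [heq]) hy2
  · have hev : ((↑) : ℝ → Circ) =ᶠ[𝓝 r] (f ∘ ((↑) : ℝ → Circ)) := by
      filter_upwards [Ioo_mem_nhds hgt hr.2] with u hu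
      refine (Equiv.Perm.viaEmbedding_apply_of_notMem (Equiv.addRight t) ι _ ?_).symm
      rintro ⟨z, hz⟩
      have hz' := (AddCircle.equivIco ρ a z).2
      have h := (AddCircle.coe_eq_coe_iff_of_mem_Ico (p := (1 : ℝ)) (a := a)
        ⟨hz'.1, by linarith [hz'.2]⟩ ⟨by linarith [hu.1], hu.2⟩).1 hz
      linarith [hz'.2, hu.1]
    exact hcoe.continuousAt.congr hev

/-- The element of `PC` given by the partial rotation of the arc from `a` to `a + ρ` by
`t ∈ ℝ / ρℤ`. -/
noncomputable def partialRotation (a ρ : ℝ) (h₀ : 0 < ρ) (h₁ : ρ < 1) (t : AddCircle ρ) : PC :=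
  PC.proj ⟨partialRotationPerm a ρ h₀ h₁ t, partialRotationPerm_mem a ρ h₀ h₁ t⟩

/-- `g` maps the open arc from `a` to `b` continuously onto the open arc from `c` to `d`, preserving
the orientation (a strictly monotone surjection between intervals is a homeomorphism). -/
def MapsArcPreserving (g : PCHat) (a b c d : ℝ) : Prop :=
  ∃ φ : ℝ → ℝ, StrictMonoOn φ (Ioo a b) ∧ φ '' Ioo a b = Ioo c d ∧
    ∀ x ∈ Ioo a b, (g : Equiv.Perm Circ) (x : Circ) = (φ x : Circ)

/-- `g` maps the open arc from `a` to `b` continuously onto the open arc from `c` to `d`, reversing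
the orientation. -/
def MapsArcReversing (g : PCHat) (a b c d : ℝ) : Prop :=
  ∃ φ : ℝ → ℝ, StrictAntiOn φ (Ioo a b) ∧ φ '' Ioo a b = Ioo c d ∧
    ∀ x ∈ Ioo a b, (g : Equiv.Perm Circ) (x : Circ) = (φ x : Circ)

/-- A 132-flip: an element `f` of `PC` with `f ^ 2 = 1` such that, for some consecutive nonzero
intervals `I₁`, `I₂`, `I₃` which partition the circle up to finitely many points, `f` maps `I₁`
onto itself reversing the orientation and exchanges `I₂` and `I₃` preserving the orientation,
with no singularity inside the three intervals. -/
def IsFlip132 (f : PC) : Prop :=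
  f ^ 2 = 1 ∧ ∃ a b c : ℝ, a < b ∧ b < c ∧ c < a + 1 ∧ ∃ g : PCHat, PC.proj g = f ∧
    MapsArcReversing g a b a b ∧ MapsArcPreserving g b c c (a + 1) ∧
    MapsArcPreserving g c (a + 1) b c

/-- A triple flip: an element `f` of `PC` with `f ^ 2 = 1` such that, for some consecutive nonzero
intervals `I₁`, `I₂`, `I₃` which partition the circle up to finitely many points, `f` maps each of
them onto itself reversing the orientation. -/
def IsTripleFlip (f : PC) : Prop :=
  f ^ 2 = 1 ∧ ∃ a b c : ℝ, a < b ∧ b < c ∧ c < a + 1 ∧ ∃ g : PCHat, PC.proj g = f ∧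
    MapsArcReversing g a b a b ∧ MapsArcReversing g b c b c ∧
    MapsArcReversing g c (a + 1) c (a + 1)

open scoped commutatorElement

/-!
A realization of `Γ` is the same as a group `G` of permutations of the circle that represents `Γ`
and contains no nontrivial finitely supported permutation (`IsRealizable.exists_lift`). Two elements
of `G` that commute up to finitely many points thus commute, and this rigidity is played against the
flip.

The group `Λ` of rotations is infinite modulo an infinite cyclic subgroup, hence has one end, and a
limit along `Λ` shows that its lift is conjugate, by a finitely supported permutation, to the
rotations themselves (`exists_finPerm_conj_translations`). So `G` may be assumed to contain the
rotations by elements of `Λ`. The commutator of a small rotation with a partial rotation permutes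
three short arcs cyclically, and the commutator of two such three-cycles whose supports overlap in
one arc is supported in a short arc. Conjugating by rotations, which now have no exceptional points,
one moves any given point by an element with support near that point (`movesLocally_of_rotations`).

It follows that an element of `G` which is the identity near `x` up to finitely many points fixes
`x` (`fixes_of_eventually_fixes_near`): otherwise it would move infinitely many points near `x`,
since it commutes with the elements supported near `x`. Conjugating elements supported near `x`,
one deduces that every element of `G` sends each point to one of its two one-sided limits there
(`apply_eq_or_eq_of_tendsto`).

For a 132-flip or a triple flip, the one-sided limits at each of the three endpoints of the arcs are
the two other endpoints. The lift of the flip would be an involution permuting these three points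
without fixed point, which is impossible by parity.
-/

/-! ### Abelian groups with one end -/

/-- An abelian group that is infinite modulo some infinite cyclic subgroup has one end: a function
on it that is invariant under each translation outside a finite set is constant outside a finite
set. -/
theorem exists_eventually_eq_const_of_almost_invariant {A Y : Type*} [AddCommGroup A] {h : A}
    (hh : ¬ IsOfFinAddOrder h) (hq : Infinite (A ⧸ AddSubgroup.zmultiples h)) (u : A → Y)
    (hu : ∀ t, ∀ᶠ g in cofinite, u (g + t) = u g) : ∃ c, ∀ᶠ g in cofinite, u g = c := by
  have hinj : Function.Injective fun n : ℤ => n • h := by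
    simpa using (injective_zsmul_iff_not_isOfFinAddOrder (x := h)).2 hh
  set F : Set A := {g | ¬ u (g + h) = u g} with hF
  have hFfin : F.Finite := eventually_cofinite.1 (hu h)
  set π : A → A ⧸ AddSubgroup.zmultiples h := QuotientAddGroup.mk with hπ
  have hπF : (π '' F).Finite := hFfin.image π
  -- on a coset of `ℤ h` that misses `F`, the function `u` is constant
  have hconst : ∀ g, π g ∉ π '' F → ∀ n : ℤ, u (g + n • h) = u g := by
    intro g hg n
    have hstep : ∀ m : ℤ, u (g + (m + 1) • h) = u (g + m • h) := by
      intro m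
      by_contra hne
      refine hg ⟨g + m • h, ?_, ?_⟩
      · rwa [hF, mem_ofPred_eq, add_assoc, ← add_one_zsmul]
      · rw [hπ, QuotientAddGroup.eq]
        exact ⟨-m, by simp⟩
    induction n using Int.induction_on with
    | zero => simp
    | succ n ih => rw [hstep, ih]
    | pred n ih => rw [← ih, ← hstep (-(n : ℤ) - 1), sub_add_cancel]
  obtain ⟨q, hq0⟩ := hπF.exists_notMem
  obtain ⟨g₀, rfl⟩ := QuotientAddGroup.mk_surjective q
  have hline : ∀ g : A, {n : ℤ | u (g + n • h) ≠ u g₀}.Finite := by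
    intro g
    have h1 : Tendsto (fun n : ℤ => g₀ + n • h) cofinite cofinite :=
      ((add_right_injective g₀).comp hinj).tendsto_cofinite
    refine (eventually_cofinite.1 (h1.eventually (hu (g - g₀)))).subset ?_
    intro n hn
    rw [mem_ofPred_eq, hconst g₀ hq0]
    convert hn using 3
    abel
  refine ⟨u g₀, eventually_cofinite.2 ?_⟩
  refine (hπF.biUnion (t := fun q => (fun n : ℤ => q.out + n • h) ''
    {n : ℤ | u (q.out + n • h) ≠ u g₀}) fun q _ => (hline _).image _).subset ?_
  intro g hg
  have hmem : π g ∈ π '' F := by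
    by_contra hcon
    obtain ⟨n, hn⟩ := (hline g).exists_notMem
    rw [mem_ofPred_eq, not_not, hconst g hcon] at hn
    exact hg hn
  rw [mem_iUnion₂]
  refine ⟨π g, hmem, ?_⟩
  obtain ⟨n, hn⟩ : -(π g).out + g ∈ AddSubgroup.zmultiples h := by
    rw [← QuotientAddGroup.eq]
    exact Quotient.out_eq (π g)
  have hn' : (π g).out + n • h = g := by
    simp only at hn
    rw [hn]; abel
  exact ⟨n, by rw [mem_ofPred_eq, hn']; exact hg, hn'⟩

/-- A self-map that is injective and moves finitely many points is bijective. -/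
theorem bijective_of_injective_of_eventually_fixed {X : Type*} {f : X → X}
    (hf : Function.Injective f) (hfix : ∀ᶠ x in cofinite, f x = x) : Function.Bijective f := by
  refine ⟨hf, fun y => ?_⟩
  have hmaps : MapsTo f {x | ¬ f x = x} {x | ¬ f x = x} := fun x hx h => hx (hf h)
  have hbij := (Set.Finite.injOn_iff_bijOn_of_mapsTo (eventually_cofinite.1 hfix) hmaps).1 hf.injOn
  by_cases hy : f y = y
  · exact ⟨y, hy⟩
  · obtain ⟨x, -, hx⟩ := hbij.surjOn hy
    exact ⟨x, hx⟩

/-- Rigidity of translations: an action of a one-ended group of translations that differs from the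
translation action at finitely many points for each group element is conjugate to it by a finitely
supported permutation. The conjugation sends `x` to the limit of `(s g)⁻¹ (x + g)` as `g` tends to
infinity. -/
theorem exists_finPerm_conj_translations {X : Type*} [AddCommGroup X] (Λ : AddSubgroup X) {h : Λ}
    (hh : ¬ IsOfFinAddOrder h) (hq : Infinite (Λ ⧸ AddSubgroup.zmultiples h))
    (s : Λ → Equiv.Perm X) (hs : ∀ t u, s (t + u) = s t * s u)
    (hnear : ∀ t : Λ, ∀ᶠ x in cofinite, s t x = x + t) :
    ∃ f : Equiv.Perm X, (∀ᶠ x in cofinite, f x = x) ∧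
      ∀ t : Λ, f⁻¹ * s t * f = Equiv.addRight (t : X) := by
  have hinj : Function.Injective fun n : ℤ => n • h := by
    simpa using (injective_zsmul_iff_not_isOfFinAddOrder (x := h)).2 hh
  have hinjN : Function.Injective fun n : ℕ => n • h := fun m n hmn => by
    have := @hinj m n (by simpa using hmn)
    exact_mod_cast this
  have : Infinite Λ := Infinite.of_injective _ hinj
  have hs0 : s 0 = 1 := by simpa using hs 0 0
  have hlim : ∀ x : X, ∃ c, ∀ᶠ g in cofinite, (s g)⁻¹ (x + (g : X)) = c := by
    intro x
    refine exists_eventually_eq_const_of_almost_invariant hh hq (fun g => (s g)⁻¹ (x + (g : X)))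
      fun t => ?_
    have h1 : Tendsto (fun g : Λ => x + (g : X)) cofinite cofinite :=
      ((add_right_injective x).comp Subtype.val_injective).tendsto_cofinite
    filter_upwards [h1.eventually (hnear t)] with g hg
    have h2 : x + ((g + t : Λ) : X) = s t (x + g) := by
      rw [hg]; push_cast; abel
    rw [h2, add_comm g t, hs, mul_inv_rev, Equiv.Perm.mul_apply,
      Equiv.Perm.inv_eq_iff_eq.2 rfl]
  choose f hf using hlim
  have hequiv : ∀ (k : Λ) (x : X), s k (f x) = f (x + k) := by
    intro k x
    have h1 : Tendsto (fun g : Λ => g + k) cofinite cofinite :=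
      (add_left_injective k).tendsto_cofinite
    obtain ⟨g, hg1, hg2⟩ := ((hf (x + k)).and (h1.eventually (hf x))).exists
    have h2 : x + ((g + k : Λ) : X) = x + k + g := by push_cast; abel
    rw [← hg1, ← hg2, h2, hs, mul_inv_rev, Equiv.Perm.mul_apply]
    exact (s k).apply_symm_apply _
  have hfinj : Function.Injective f := by
    intro x y hxy
    obtain ⟨g, hg1, hg2⟩ := ((hf x).and (hf y)).exists
    have h1 := hg1.trans (hxy.trans hg2.symm)
    exact add_left_injective _ ((s g)⁻¹.injective h1)
  set F : Set X := {x | ¬ s h x = x + h} with hF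
  have hFfin : F.Finite := eventually_cofinite.1 (hnear h)
  have hpos : ∀ x, f x ≠ x → ∃ n : ℕ, x + ((n • h : Λ) : X) ∈ F := by
    intro x hx
    by_contra! hcon
    have h1 : ∀ n : ℕ, s (n • h) x = x + ((n • h : Λ) : X) := by
      intro n
      induction n with
      | zero => simp [hs0]
      | succ n ih =>
        have h2 := hcon n
        rw [hF, mem_ofPred_eq, not_not] at h2
        rw [succ_nsmul', hs, Equiv.Perm.mul_apply, ih, h2]
        push_cast; abel
    obtain ⟨n, hn⟩ := (hinjN.tendsto_cofinite.eventually (hf x)).exists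
    apply hx
    rw [← hn, ← h1 n, Equiv.Perm.inv_eq_iff_eq.2 rfl]
  have hneg : ∀ x, f x ≠ x → ∃ n : ℕ, x - (((n + 1) • h : Λ) : X) ∈ F := by
    intro x hx
    by_contra! hcon
    have h1 : ∀ n : ℕ, s (n • h) (x - ((n • h : Λ) : X)) = x := by
      intro n
      induction n with
      | zero => simp [hs0]
      | succ n ih =>
        have h2 := hcon n
        rw [hF, mem_ofPred_eq, not_not] at h2
        have h3 : x - (((n + 1) • h : Λ) : X) + h = x - ((n • h : Λ) : X) := by
          rw [succ_nsmul]; push_cast; abel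
        rw [succ_nsmul, hs, Equiv.Perm.mul_apply, ← succ_nsmul, h2, h3, ih]
    have h2 : Function.Injective fun n : ℕ => -(n • h) := neg_injective.comp hinjN
    obtain ⟨n, hn⟩ := (h2.tendsto_cofinite.eventually (hf x)).exists
    apply hx
    have h3 : s (-(n • h)) * s (n • h) = 1 := by rw [← hs, neg_add_cancel, hs0]
    rw [← hn, eq_inv_of_mul_eq_one_left h3, inv_inv]
    have h4 := h1 n
    rwa [sub_eq_add_neg] at h4
  have hfix : ∀ᶠ x in cofinite, f x = x := by
    rw [eventually_cofinite]
    refine (hFfin.biUnion (t := fun y => ⋃ z ∈ F, {x | ∃ n m : ℕ, x + ((n • h : Λ) : X) = y ∧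
      x - (((m + 1) • h : Λ) : X) = z}) fun y _ => hFfin.biUnion fun z _ => ?_).subset ?_
    · -- the sum `n + m + 1` is determined by `y - z`, so only finitely many `n` occur
      by_cases hex : ∃ n m : ℕ, y - z = ((n + (m + 1)) • h : Λ)
      · obtain ⟨n₀, m₀, h₀⟩ := hex
        refine ((finite_Iic (n₀ + (m₀ + 1))).image fun n : ℕ => y - ((n • h : Λ) : X)).subset ?_
        rintro x ⟨n, m, hn, hm⟩
        refine ⟨n, ?_, ?_⟩
        · have h1 : ((n + (m + 1)) • h : Λ) = (n₀ + (m₀ + 1)) • h := by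
            apply Subtype.val_injective
            rw [← h₀, ← hn, ← hm, add_nsmul]
            push_cast; abel
          have h2 := hinjN h1
          rw [mem_Iic]; omega
        · simp only
          rw [← hn]; abel
      · refine Set.finite_empty.subset ?_
        rintro x ⟨n, m, hn, hm⟩
        refine hex ⟨n, m, ?_⟩
        rw [← hn, ← hm, add_sub_sub_cancel, add_nsmul h n (m + 1), AddSubgroup.coe_add]
    · intro x hx
      obtain ⟨n, hn⟩ := hpos x hx
      obtain ⟨m, hm⟩ := hneg x hx
      rw [mem_iUnion₂]
      refine ⟨_, hn, ?_⟩
      rw [mem_iUnion₂]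
      exact ⟨_, hm, n, m, rfl, rfl⟩
  refine ⟨Equiv.ofBijective f (bijective_of_injective_of_eventually_fixed hfinj hfix), hfix, ?_⟩
  intro t
  rw [mul_assoc, inv_mul_eq_iff_eq_mul]
  ext x
  exact hequiv t x

/-! ### The rank hypothesis -/

theorem exists_not_isOfFinAddOrder_of_qRank_ne_zero {A : Type} [AddCommGroup A]
    (hA : qRank A ≠ 0) : ∃ h : A, ¬ IsOfFinAddOrder h := by
  by_contra! hcon
  apply hA
  have hz : ∀ z : ℚ ⊗[ℤ] A, z = 0 := by
    intro z
    induction z using TensorProduct.induction_on with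
    | zero => rfl
    | add x y hx hy => rw [hx, hy, add_zero]
    | tmul q t =>
      obtain ⟨n, hn, hnt⟩ := isOfFinAddOrder_iff_nsmul_eq_zero.1 (hcon t)
      have hn' : (n : ℚ) ≠ 0 := by exact_mod_cast hn.ne'
      have h1 : q = (n : ℤ) • (q / n) := by
        rw [zsmul_eq_mul]; push_cast; field_simp
      rw [h1, TensorProduct.smul_tmul, natCast_zsmul, hnt, TensorProduct.tmul_zero]
  have : Subsingleton (ℚ ⊗[ℤ] A) := ⟨fun x y => (hz x).trans (hz y).symm⟩
  exact rank_subsingleton' _ _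

theorem qRank_le_one_of_finite_quotient {A : Type} [AddCommGroup A] (h : A)
    [Finite (A ⧸ AddSubgroup.zmultiples h)] : qRank A ≤ 1 := by
  have hn : (Nat.card (A ⧸ AddSubgroup.zmultiples h) : ℚ) ≠ 0 := by
    exact_mod_cast Nat.card_pos.ne'
  refine rank_le_one ((1 : ℚ) ⊗ₜ[ℤ] h) fun z => ?_
  induction z using TensorProduct.induction_on with
  | zero => exact ⟨0, by simp⟩
  | add x y hx hy =>
    obtain ⟨c, rfl⟩ := hx
    obtain ⟨d, rfl⟩ := hy
    exact ⟨c + d, add_smul _ _ _⟩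
  | tmul q t =>
    set n := Nat.card (A ⧸ AddSubgroup.zmultiples h)
    obtain ⟨m, hm⟩ : n • t ∈ AddSubgroup.zmultiples h := by
      rw [← QuotientAddGroup.eq_zero_iff, QuotientAddGroup.mk_nsmul]
      exact card_nsmul_eq_zero'
    simp only at hm
    have h1 : q = (n : ℤ) • (q / n) := by
      rw [zsmul_eq_mul]; push_cast; field_simp
    refine ⟨m • (q / n), ?_⟩
    conv_rhs => rw [h1, TensorProduct.smul_tmul, natCast_zsmul, ← hm]
    rw [TensorProduct.smul_tmul', ← TensorProduct.smul_tmul, smul_eq_mul, mul_one]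

/-- An abelian group of rank at least two, or of rank one and not finitely generated, is infinite
modulo some infinite cyclic subgroup. -/
theorem exists_infinite_quotient_of_qRank {A : Type} [AddCommGroup A]
    (hA : 2 ≤ qRank A ∨ (¬ AddGroup.FG A ∧ qRank A = 1)) :
    ∃ h : A, ¬ IsOfFinAddOrder h ∧ Infinite (A ⧸ AddSubgroup.zmultiples h) := by
  have h0 : qRank A ≠ 0 := by
    rcases hA with hA | ⟨-, hA⟩
    · exact (lt_of_lt_of_le two_pos hA).ne'
    · rw [hA]; exact one_ne_zero
  obtain ⟨h, hh⟩ := exists_not_isOfFinAddOrder_of_qRank_ne_zero h0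
  refine ⟨h, hh, ?_⟩
  by_contra hfin
  rw [not_infinite_iff_finite] at hfin
  rcases hA with hA | ⟨hA, -⟩
  · have h1 := hA.trans (qRank_le_one_of_finite_quotient h)
    exact absurd h1 (not_le.2 Cardinal.one_lt_two)
  · apply hA
    have h1 : Module.Finite ℤ (AddSubgroup.toIntSubmodule (AddSubgroup.zmultiples h)) := by
      rw [Module.Finite.iff_addGroup_fg]
      have h2 : AddGroup.FG (AddSubgroup.zmultiples h) := by
        rw [AddSubgroup.zmultiples_eq_closure, ← Finset.coe_singleton]
        exact AddGroup.closure_finset_fg _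
      exact h2
    have : Finite (A ⧸ AddSubgroup.toIntSubmodule (AddSubgroup.zmultiples h)) := hfin
    have h2 : Module.Finite ℤ (A ⧸ AddSubgroup.toIntSubmodule (AddSubgroup.zmultiples h)) :=
      inferInstance
    exact Module.Finite.iff_addGroup_fg.1 (Module.Finite.of_submodule_quotient
      (AddSubgroup.toIntSubmodule (AddSubgroup.zmultiples h)))

/-! ### Permutations moving the points of short arcs -/

/-- The commutator of two permutations moves only the points that both of them move, and the images
of those points under either of them. -/
theorem moved_commutator_subset {X : Type*} (g h : Equiv.Perm X) :
    {x | ⁅g, h⁆ x ≠ x} ⊆ {x | g x ≠ x ∧ h x ≠ x} ∪ g '' {x | g x ≠ x ∧ h x ≠ x} ∪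
      h '' {x | g x ≠ x ∧ h x ≠ x} := by
  intro x hx
  by_contra hcon
  simp only [mem_union, mem_image, mem_ofPred_eq, not_or, not_exists, not_and, not_not] at hcon
  obtain ⟨⟨h1, h2⟩, h3⟩ := hcon
  apply hx
  have e1 : g (g⁻¹ x) = x := g.apply_symm_apply x
  have e2 : h (h⁻¹ x) = x := h.apply_symm_apply x
  rw [commutatorElement_def, Equiv.Perm.mul_apply, Equiv.Perm.mul_apply, Equiv.Perm.mul_apply]
  by_cases hhx : h x = x
  · rw [Equiv.Perm.inv_eq_iff_eq.2 hhx.symm]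
    have h4 : h (g⁻¹ x) = g⁻¹ x := by
      by_contra hne
      have h5 : g (g⁻¹ x) ≠ g⁻¹ x := by
        intro h6
        rw [e1] at h6
        rw [← h6] at hne
        exact hne hhx
      exact h2 _ ⟨h5, hne⟩ e1
    rw [h4, e1]
  · have hgx : g x = x := by
      by_contra hne
      exact hhx (h1 hne)
    have h4 : g (h⁻¹ x) = h⁻¹ x := by
      by_contra hne
      refine h3 _ ⟨hne, ?_⟩ e2
      intro h6
      rw [e2] at h6
      rw [← h6] at hne
      exact hne hgx
    rw [Equiv.Perm.inv_eq_iff_eq.2 h4.symm, e2, hgx]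

theorem circ_coe_add_one (x : ℝ) : ((x + 1 : ℝ) : Circ) = (x : Circ) := AddCircle.coe_add_period 1 x

theorem circ_eventually_cofinite_of_Ico (a : ℝ) {P : Circ → Prop}
    (h : ∀ᶠ x : ℝ in cofinite, x ∈ Ico a (a + 1) → P (x : Circ)) : ∀ᶠ p in cofinite, P p := by
  rw [eventually_cofinite] at h ⊢
  refine (h.image ((↑) : ℝ → Circ)).subset fun p hp => ?_
  have hx : ((AddCircle.equivIco 1 a p : ℝ) : Circ) = p := AddCircle.coe_equivIco
  refine ⟨_, ?_, hx⟩
  intro hcon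
  exact hp (hx ▸ hcon (AddCircle.equivIco 1 a p).2)

/-- Up to finitely many points, `g` translates the open arc from `u` to `v` by `t`. -/
def TranslatesArc (g : Equiv.Perm Circ) (u v t : ℝ) : Prop :=
  ∀ᶠ x : ℝ in cofinite, x ∈ Ioo u v → g (x : Circ) = ((x + t : ℝ) : Circ)

namespace TranslatesArc

variable {g h : Equiv.Perm Circ} {u v t u' v' s w : ℝ}

theorem mono (hg : TranslatesArc g u v t) (hu : u ≤ u') (hv : v' ≤ v) :
    TranslatesArc g u' v' t := by
  filter_upwards [hg] with x hx hxm
  exact hx ⟨by linarith [hxm.1], by linarith [hxm.2]⟩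

theorem mul (hh : TranslatesArc h u' v' s) (hg : TranslatesArc g u v t) (hu : u' ≤ u + t)
    (hv : v + t ≤ v') (hw : t + s = w) : TranslatesArc (h * g) u v w := by
  have h1 : Tendsto (fun x : ℝ => x + t) cofinite cofinite :=
    (add_left_injective t).tendsto_cofinite
  filter_upwards [hg, h1.eventually hh] with x hx hy hxm
  rw [Equiv.Perm.mul_apply, hx hxm, hy ⟨by linarith [hxm.1], by linarith [hxm.2]⟩, ← hw, add_assoc]

theorem inv (hg : TranslatesArc g u v t) : TranslatesArc g⁻¹ (u + t) (v + t) (-t) := by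
  have h1 : Tendsto (fun x : ℝ => x - t) cofinite cofinite :=
    (sub_left_injective (b := t)).tendsto_cofinite
  filter_upwards [h1.eventually hg] with x hx hxm
  rw [Equiv.Perm.inv_eq_iff_eq, ← sub_eq_add_neg,
    hx ⟨by linarith [hxm.1], by linarith [hxm.2]⟩, sub_add_cancel]

theorem addRight (t u v : ℝ) : TranslatesArc (Equiv.addRight (t : Circ)) u v t :=
  Eventually.of_forall fun x _ => by simp

theorem sub_one (hg : TranslatesArc g u v t) : TranslatesArc g (u - 1) (v - 1) t := by
  have h1 : Tendsto (fun x : ℝ => x + 1) cofinite cofinite :=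
    (add_left_injective 1).tendsto_cofinite
  filter_upwards [h1.eventually hg] with x hx hxm
  have h2 := hx ⟨by linarith [hxm.1], by linarith [hxm.2]⟩
  rwa [circ_coe_add_one, add_right_comm, circ_coe_add_one] at h2

theorem conj_addRight (hg : TranslatesArc g u v t) (ν : ℝ) :
    TranslatesArc (Equiv.addRight (ν : Circ) * g * (Equiv.addRight (ν : Circ))⁻¹)
      (u + ν) (v + ν) t := by
  have h1 := ((addRight ν u v).inv)
  exact ((addRight ν (u + t) (v + t)).mul hg le_rfl le_rfl rfl).mul h1 (by linarith) (by linarith)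
    (by ring)

end TranslatesArc

section ThreeCycle

variable {r : Equiv.Perm Circ} {a ρ d l : ℝ}

/-- The commutator of a rotation by a small `l` with a partial rotation by `d` permutes cyclically,
by translations, the three arcs of length `l` starting at `a`, `a + ρ` and `a + ρ - d`, and is
trivial elsewhere. The clauses list its values on the first two of these arcs and between the
three. -/
theorem translatesArc_commutator_partialRotation (hl : 0 < l) (hld : l < d) (hlρ : l < ρ - d)
    (hl1 : l < 1 - ρ) (h₁ : TranslatesArc r a (a + ρ - d) d)
    (h₂ : TranslatesArc r (a + ρ - d) (a + ρ) (d - ρ)) (h₃ : TranslatesArc r (a + ρ) (a + 1) 0) :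
    let c := ⁅Equiv.addRight (l : Circ), r⁻¹⁆
    TranslatesArc c a (a + l) ρ ∧ TranslatesArc c (a + l) (a + ρ - d) 0 ∧
      TranslatesArc c (a + ρ - d + l) (a + ρ) 0 ∧ TranslatesArc c (a + ρ) (a + ρ + l) (-d) ∧
      TranslatesArc c (a + ρ + l) (a + 1) 0 := by
  have key : ∀ {u v t u' v' s w : ℝ}, TranslatesArc r u v t → TranslatesArc r⁻¹ u' v' s →
      u' ≤ u + t - l → v + t - l ≤ v' → t + s = w →
      TranslatesArc ⁅Equiv.addRight (l : Circ), r⁻¹⁆ u v w := by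
    intro u v t u' v' s w h h' hu hv hw
    have e1 := (TranslatesArc.addRight l (u + t - l) (v + t - l)).inv
    have e2 := e1.mul h (by linarith) (by linarith) rfl
    have e3 := h'.mul e2 (by linarith) (by linarith) rfl
    have e4 := (TranslatesArc.addRight l (u + (t + -l + s)) (v + (t + -l + s))).mul e3 le_rfl
      le_rfl (w := w) (by linarith)
    rw [commutatorElement_def, inv_inv]
    simpa only [mul_assoc] using e4
  refine ⟨key (h₁.mono le_rfl (by linarith)) h₂.inv ?_ ?_ ?_,
    key (h₁.mono (by linarith) le_rfl) h₁.inv ?_ ?_ ?_,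
    key (h₂.mono (by linarith) le_rfl) h₂.inv ?_ ?_ ?_,
    key (h₃.mono le_rfl (by linarith)) h₁.inv ?_ ?_ ?_,
    key (h₃.mono (by linarith) le_rfl) h₃.inv ?_ ?_ ?_⟩ <;> linarith

/-- For `ν` slightly larger than `d`, the only arc on which both the three-cycle above and its
conjugate by the rotation by `ν` are nontrivial is the one from `a + ρ + (ν - d)` to `a + ρ + l`.
The three-cycle moves it by `-d` and the inverse of the conjugate moves it by `d`, so that the
commutator of these two lives near `a + ρ`. -/
theorem commutator_threeCycle_short {c : Equiv.Perm Circ} {ν : ℝ} (hνd : d < ν)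
    (hνl : ν < d + l) (hld : l < d) (hdρ : 4 * d < ρ) (hd1 : 4 * d < 1 - ρ)
    (h₁ : TranslatesArc c a (a + l) ρ) (h₂ : TranslatesArc c (a + l) (a + ρ - d) 0)
    (h₃ : TranslatesArc c (a + ρ - d + l) (a + ρ) 0)
    (h₄ : TranslatesArc c (a + ρ) (a + ρ + l) (-d))
    (h₅ : TranslatesArc c (a + ρ + l) (a + 1) 0) :
    let k := ⁅(Equiv.addRight (ν : Circ) * c * (Equiv.addRight (ν : Circ))⁻¹)⁻¹, c⁆
    TranslatesArc k (a + ρ + ν - d) (a + ρ + l) d ∧ ∀ᶠ p in cofinite, k p ≠ p →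
      p ∈ ((↑) : ℝ → Circ) '' Ioo (a + ρ + ν - 2 * d) (a + ρ + l + d) := by
  set c' := Equiv.addRight (ν : Circ) * c * (Equiv.addRight (ν : Circ))⁻¹ with hc'
  set u := a + ρ + ν - d with hu
  set v := a + ρ + l with hv
  have k₂ := h₂.conj_addRight ν
  have k₄ := h₄.conj_addRight ν
  have k₅ := (h₅.conj_addRight ν).sub_one
  rw [← hc'] at k₂ k₄ k₅
  -- the two permutations on the arc on which their supports overlap
  have hc : TranslatesArc c u v (-d) := h₄.mono (by linarith) le_rfl
  have hc'i : TranslatesArc c'⁻¹ u v d := by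
    have := k₄.inv.mono (u' := u) (v' := v) (by linarith) (by linarith)
    rwa [neg_neg] at this
  constructor
  · have e1 : TranslatesArc c⁻¹ u v (-ρ) := h₁.inv.mono (by linarith) (by linarith)
    have e2 : TranslatesArc (c'⁻¹)⁻¹ (u - ρ) (v - ρ) 0 := by
      rw [inv_inv]
      exact k₅.mono (by linarith) (by linarith)
    have e3 := (e2.mul e1 (by linarith) (by linarith) rfl)
    have e4 := h₁.mul e3 (by linarith) (by linarith) rfl
    have e5 := hc'i.mul e4 (by linarith) (by linarith) (w := d) (by ring)
    rw [commutatorElement_def]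
    simpa only [mul_assoc, inv_inv] using e5
  · have hZ : ∀ᶠ p : Circ in cofinite, c'⁻¹ p ≠ p ∧ c p ≠ p →
        p ∈ ((↑) : ℝ → Circ) '' Ioo u v ∧ c p ∈ ((↑) : ℝ → Circ) '' Ioo (u - d) (v - d) ∧
          c'⁻¹ p ∈ ((↑) : ℝ → Circ) '' Ioo (u + d) (v + d) := by
      apply circ_eventually_cofinite_of_Ico a
      have hfin : ({a, a + l, a + ρ - d, a + ρ - d + l, a + ρ, v, u} : Set ℝ).Finite := by simp
      filter_upwards [h₂, h₃, h₅, k₂, k₅, hc, hc'i, hfin.eventually_cofinite_notMem]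
        with x x₂ x₃ x₅ y₂ y₅ xc xc' hne hx hmoved
      simp only [mem_insert_iff, mem_singleton_iff, not_or] at hne
      obtain ⟨n1, n2, n3, n4, n5, n6, n7⟩ := hne
      rw [add_zero] at x₂ x₃ x₅ y₂ y₅
      have hmoved' : c' (x : Circ) ≠ x := fun h => hmoved.1 (Equiv.Perm.inv_eq_iff_eq.2 h.symm)
      have hxu : x ∈ Ioo u v := by
        have hx2 := hx.2
        have hxa : a < x := lt_of_le_of_ne hx.1 (Ne.symm n1)
        refine ⟨?_, ?_⟩
        · by_contra hcon
          have hxu : x < u := lt_of_le_of_ne (not_lt.1 hcon) n7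
          rcases lt_or_gt_of_ne n2 with h | h
          · exact hmoved' (y₅ ⟨by linarith, by linarith⟩)
          · rcases lt_or_gt_of_ne n3 with h' | h'
            · exact hmoved.2 (x₂ ⟨h, h'⟩)
            · exact hmoved' (y₂ ⟨by linarith, by linarith⟩)
        · by_contra hcon
          have hxv : v < x := lt_of_le_of_ne (not_lt.1 hcon) (Ne.symm n6)
          exact hmoved.2 (x₅ ⟨hxv, hx2⟩)
      exact ⟨⟨x, hxu, rfl⟩, ⟨x + -d, ⟨by linarith [hxu.1], by linarith [hxu.2]⟩, (xc hxu).symm⟩,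
        ⟨x + d, ⟨by linarith [hxu.1], by linarith [hxu.2]⟩, (xc' hxu).symm⟩⟩
    set k := ⁅c'⁻¹, c⁆ with hk
    have t1 : Tendsto (fun p : Circ => c p) cofinite cofinite := c.injective.tendsto_cofinite
    have t2 : Tendsto (fun p : Circ => c⁻¹ p) cofinite cofinite :=
      (c⁻¹).injective.tendsto_cofinite
    have t3 : Tendsto (fun p : Circ => c' p) cofinite cofinite := c'.injective.tendsto_cofinite
    filter_upwards [hZ, t2.eventually hZ, t3.eventually hZ] with p h1 h2 h3 hp
    rcases moved_commutator_subset _ _ hp with (hp | ⟨q, hq, rfl⟩) | ⟨q, hq, rfl⟩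
    · obtain ⟨x, hx, rfl⟩ := (h1 hp).1
      exact ⟨x, ⟨by linarith [hx.1], by linarith [hx.2]⟩, rfl⟩
    · have e : c' (c'⁻¹ q) = q := c'.apply_symm_apply q
      rw [e] at h3
      obtain ⟨x, hx, hxe⟩ := (h3 hq).2.2
      exact ⟨x, ⟨by linarith [hx.1], by linarith [hx.2]⟩, hxe⟩
    · have e : c⁻¹ (c q) = q := c.symm_apply_apply q
      rw [e] at h2
      obtain ⟨x, hx, hxe⟩ := (h2 hq).2.1
      exact ⟨x, ⟨by linarith [hx.1], by linarith [hx.2]⟩, hxe⟩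

end ThreeCycle

/-- A partial rotation by `d` translates the two parts of its arc by `d` and `d - ρ`. -/
theorem translatesArc_partialRotationPerm {r : Equiv.Perm Circ} {a ρ d : ℝ} (h₀ : 0 < ρ)
    (h₁ : ρ < 1) (hd : 0 < d) (hdρ : d < ρ)
    (hr : ∀ᶠ x in cofinite, r x = partialRotationPerm a ρ h₀ h₁ (d : AddCircle ρ) x) :
    TranslatesArc r a (a + ρ - d) d ∧ TranslatesArc r (a + ρ - d) (a + ρ) (d - ρ) ∧
      TranslatesArc r (a + ρ) (a + 1) 0 := by
  have : Fact (0 < ρ) := ⟨h₀⟩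
  set ι := arcEmb a ρ h₀ h₁ with hι
  have hιcoe : ∀ x ∈ Ico a (a + ρ), ι ((x : ℝ) : AddCircle ρ) = ((x : ℝ) : Circ) := by
    intro x hx
    change ((AddCircle.equivIco ρ a ((x : ℝ) : AddCircle ρ) : ℝ) : Circ) = _
    rw [AddCircle.equivIco_coe_eq hx]
  have hval : ∀ x ∈ Ico a (a + ρ), partialRotationPerm a ρ h₀ h₁ (d : AddCircle ρ) (x : Circ)
      = ι ((x + d : ℝ) : AddCircle ρ) := by
    intro x hx
    rw [← hιcoe x hx, AddCircle.coe_add]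
    exact Equiv.Perm.viaEmbedding_apply (Equiv.addRight (d : AddCircle ρ)) ι _
  have hreal : ∀ u v : ℝ, a ≤ u → v ≤ a + 1 → ∀ᶠ x : ℝ in cofinite, x ∈ Ioo u v →
      r (x : Circ) = partialRotationPerm a ρ h₀ h₁ (d : AddCircle ρ) x := by
    intro u v hu hv
    rw [eventually_cofinite] at hr ⊢
    have hinj : InjOn ((↑) : ℝ → Circ) (Ioo u v) := fun x hx y hy hxy =>
      (AddCircle.coe_eq_coe_iff_of_mem_Ico (p := (1 : ℝ)) (a := a)
        ⟨by linarith [hx.1], by linarith [hx.2]⟩ ⟨by linarith [hy.1], by linarith [hy.2]⟩).1 hxy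
    refine Set.Finite.of_finite_image (hr.subset ?_) (hinj.mono ?_) (f := ((↑) : ℝ → Circ))
    · rintro _ ⟨x, hx, rfl⟩
      exact fun h => hx fun _ => h
    · intro x hx
      by_contra hcon
      exact hx fun h => absurd h hcon
  refine ⟨?_, ?_, ?_⟩
  · filter_upwards [hreal a (a + ρ - d) le_rfl (by linarith)] with x hx hxm
    rw [hx hxm, hval x ⟨hxm.1.le, by linarith [hxm.2]⟩,
      hιcoe _ ⟨by linarith [hxm.1], by linarith [hxm.2]⟩]
  · filter_upwards [hreal (a + ρ - d) (a + ρ) (by linarith) (by linarith)] with x hx hxm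
    have hper : ((x + d : ℝ) : AddCircle ρ) = ((x + (d - ρ) : ℝ) : AddCircle ρ) := by
      rw [← AddCircle.coe_add_period ρ (x + (d - ρ))]
      congr 1; ring
    rw [hx hxm, hval x ⟨by linarith [hxm.1], hxm.2⟩, hper,
      hιcoe _ ⟨by linarith [hxm.1], by linarith [hxm.2]⟩]
  · filter_upwards [hreal (a + ρ) (a + 1) (by linarith) le_rfl] with x hx hxm
    rw [hx hxm, add_zero]
    refine Equiv.Perm.viaEmbedding_apply_of_notMem (Equiv.addRight (d : AddCircle ρ)) ι _ ?_
    rintro ⟨z, hz⟩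
    have hz' := (AddCircle.equivIco ρ a z).2
    have h := (AddCircle.coe_eq_coe_iff_of_mem_Ico (p := (1 : ℝ)) (a := a)
      ⟨hz'.1, by linarith [hz'.2]⟩ ⟨by linarith [hxm.1], hxm.2⟩).1 hz
    linarith [hz'.2, hxm.1]

/-- A dense subset of a circle has representatives in every interval. -/
theorem exists_coe_mem_of_dense {p : ℝ} {S : Set (AddCircle p)} (hS : Dense S) {u v : ℝ}
    (huv : u < v) : ∃ x ∈ Ioo u v, (x : AddCircle p) ∈ S := by
  have h1 : Dense (((↑) : ℝ → AddCircle p) ⁻¹' S) :=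
    hS.preimage QuotientAddGroup.isOpenMap_coe
  obtain ⟨x, hx, hxS⟩ := h1.exists_mem_open isOpen_Ioo (nonempty_Ioo.2 huv)
  exact ⟨x, hxS, hx⟩

/-- A group of permutations of the circle moves points locally if every point is moved forward by an
arbitrarily small amount by an element of the group that is the identity, up to finitely many
points, outside an arbitrarily small arc around the point. -/
def MovesLocally (G : Subgroup (Equiv.Perm Circ)) : Prop :=
  ∀ y ε : ℝ, 0 < ε → ∃ k ∈ G, ∃ d : ℝ, 0 < d ∧ d < ε ∧ k (y : Circ) = ((y + d : ℝ) : Circ) ∧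
    ∀ᶠ p in cofinite, k p ≠ p → p ∈ ((↑) : ℝ → Circ) '' Ioo (y - ε) (y + ε)

/-- A group containing, exactly, a dense group of rotations and, up to finitely many points, a dense
group of partial rotations moves points locally. -/
theorem movesLocally_of_rotations {G : Subgroup (Equiv.Perm Circ)} {Λ : AddSubgroup Circ}
    (hΛ : Dense (Λ : Set Circ)) (hrot : ∀ t ∈ Λ, Equiv.addRight t ∈ G) {a ρ : ℝ} (h₀ : 0 < ρ)
    (h₁ : ρ < 1) {D : AddSubgroup (AddCircle ρ)} (hD : Dense (D : Set (AddCircle ρ)))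
    (hpart : ∀ t ∈ D, ∃ r ∈ G, ∀ᶠ x in cofinite, r x = partialRotationPerm a ρ h₀ h₁ t x) :
    MovesLocally G := by
  intro y ε hε
  obtain ⟨d, ⟨hd0, hdm⟩, hdD⟩ := exists_coe_mem_of_dense hD
    (u := 0) (v := min (ε / 4) (min (ρ / 4) ((1 - ρ) / 4))) (by
      refine lt_min (by linarith) (lt_min (by linarith) (by linarith)))
  obtain ⟨hdε, hdm⟩ := lt_min_iff.1 hdm
  obtain ⟨hdρ, hd1⟩ := lt_min_iff.1 hdm
  obtain ⟨r, hrG, hr⟩ := hpart _ hdD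
  obtain ⟨r₁, r₂, r₃⟩ := translatesArc_partialRotationPerm h₀ h₁ hd0 (by linarith) hr
  obtain ⟨l, ⟨hl0, hld⟩, hlΛ⟩ := exists_coe_mem_of_dense hΛ hd0
  obtain ⟨ν, ⟨hνd, hνl⟩, hνΛ⟩ := exists_coe_mem_of_dense hΛ (show d < d + l by linarith)
  obtain ⟨c₁, c₂, c₃, c₄, c₅⟩ := translatesArc_commutator_partialRotation hl0 hld (by linarith)
    (by linarith) r₁ r₂ r₃
  obtain ⟨hk, hks⟩ := commutator_threeCycle_short hνd hνl hld (by linarith) (by linarith)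
    c₁ c₂ c₃ c₄ c₅
  have hcomm : ∀ {g h : Equiv.Perm Circ}, g ∈ G → h ∈ G → ⁅g, h⁆ ∈ G := fun hg hh =>
    G.mul_mem (G.mul_mem (G.mul_mem hg hh) (G.inv_mem hg)) (G.inv_mem hh)
  have hcG := hcomm (hrot _ hlΛ) (G.inv_mem hrG)
  have hkG := hcomm (G.inv_mem (G.mul_mem (G.mul_mem (hrot _ hνΛ) hcG) (G.inv_mem (hrot _ hνΛ))))
    hcG
  set k := ⁅(Equiv.addRight (ν : Circ) * ⁅Equiv.addRight (l : Circ), r⁻¹⁆ *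
    (Equiv.addRight (ν : Circ))⁻¹)⁻¹, ⁅Equiv.addRight (l : Circ), r⁻¹⁆⁆ with hkdef
  set u := a + ρ + ν - d with hu
  set v := a + ρ + l with hv
  have huv : u < v := by linarith
  -- a rotation of the group carries `y` to a point of the arc where `k` acts as a translation
  obtain ⟨τ, hτΛ, hτu, hτk⟩ : ∃ τ : ℝ, (τ : Circ) ∈ Λ ∧ y - τ ∈ Ioo u v ∧
      k ((y - τ : ℝ) : Circ) = ((y - τ + d : ℝ) : Circ) := by
    have hinf : {τ : ℝ | (τ : Circ) ∈ Λ ∧ y - τ ∈ Ioo u v}.Infinite := by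
      have h1 : Dense (((↑) : ℝ → Circ) ⁻¹' (Λ : Set Circ)) :=
        hΛ.preimage QuotientAddGroup.isOpenMap_coe
      intro hfin
      have h2 : IsOpen (Ioo (y - v) (y - u) \ {τ : ℝ | (τ : Circ) ∈ Λ ∧ y - τ ∈ Ioo u v}) :=
        isOpen_Ioo.sdiff hfin.isClosed
      obtain ⟨τ, hτ, hτ'⟩ := h1.exists_mem_open h2
        ((Ioo_infinite (by linarith)).sdiff hfin).nonempty
      exact hτ'.2 ⟨hτ, by linarith [hτ'.1.2], by linarith [hτ'.1.1]⟩
    have t1 : Tendsto (fun τ : ℝ => y - τ) cofinite cofinite :=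
      (sub_right_injective (b := y)).tendsto_cofinite
    have hfin := eventually_cofinite.1 (t1.eventually hk)
    obtain ⟨τ, ⟨hτ1, hτ2⟩, hτ3⟩ := (hinf.sdiff hfin).nonempty
    exact ⟨τ, hτ1, hτ2, (not_not.1 hτ3) hτ2⟩
  refine ⟨Equiv.addRight (τ : Circ) * k * (Equiv.addRight (τ : Circ))⁻¹,
    G.mul_mem (G.mul_mem (hrot _ hτΛ) hkG) (G.inv_mem (hrot _ hτΛ)), d, hd0, by linarith, ?_, ?_⟩
  · have e : (Equiv.addRight (τ : Circ))⁻¹ (y : Circ) = ((y - τ : ℝ) : Circ) := by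
      rw [Equiv.Perm.inv_eq_iff_eq]; simp
    rw [Equiv.Perm.mul_apply, Equiv.Perm.mul_apply, e, hτk, Equiv.coe_addRight]
    change ((y - τ + d : ℝ) : Circ) + ((τ : ℝ) : Circ) = _
    rw [← AddCircle.coe_add]
    congr 1; ring
  · have t1 : Tendsto (fun p : Circ => (Equiv.addRight (τ : Circ))⁻¹ p) cofinite cofinite :=
      ((Equiv.addRight (τ : Circ))⁻¹).injective.tendsto_cofinite
    filter_upwards [t1.eventually hks] with p hp hmoved
    have e : Equiv.addRight (τ : Circ) ((Equiv.addRight (τ : Circ))⁻¹ p) = p :=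
      (Equiv.addRight (τ : Circ)).apply_symm_apply p
    obtain ⟨x, hx, hxp⟩ := hp fun h => hmoved (by
      rw [Equiv.Perm.mul_apply, Equiv.Perm.mul_apply, h, e])
    refine ⟨x + τ, ⟨by linarith [hx.1, hτu.2], by linarith [hx.2, hτu.1]⟩, ?_⟩
    rw [← e, ← hxp, Equiv.coe_addRight, AddCircle.coe_add]

/-! ### Groups without finitely supported elements -/

theorem circ_image_Ioo_mem_nhds (y : ℝ) {ε : ℝ} (hε : 0 < ε) :
    ((↑) : ℝ → Circ) '' Ioo (y - ε) (y + ε) ∈ 𝓝 (y : Circ) :=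
  circ_coe_isOpenQuotientMap.isOpenMap.image_mem_nhds
    (Ioo_mem_nhds (by linarith) (by linarith))

theorem exists_circ_image_Ioo_subset {y : ℝ} {U : Set Circ} (hU : U ∈ 𝓝 (y : Circ)) :
    ∃ ε, 0 < ε ∧ ε ≤ 1 / 2 ∧ ((↑) : ℝ → Circ) '' Ioo (y - ε) (y + ε) ⊆ U := by
  have h1 : ((↑) : ℝ → Circ) ⁻¹' U ∈ 𝓝 y :=
    circ_coe_isOpenQuotientMap.continuous.continuousAt hU
  obtain ⟨δ, hδ, hball⟩ := Metric.mem_nhds_iff.1 h1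
  refine ⟨min δ (1 / 2), lt_min hδ (by norm_num), min_le_right _ _, ?_⟩
  rintro _ ⟨x, hx, rfl⟩
  apply hball
  have := min_le_left δ (1 / 2)
  rw [Metric.mem_ball, Real.dist_eq, abs_lt]
  constructor <;> linarith [hx.1, hx.2]

/-- If an element is the identity near `x` up to finitely many points, then it fixes `x`.
Otherwise consider the last point that it moves in a short arc around `x`, and an element with
support near this point that moves it forward: the two commute, because their commutator is finitely
supported, so the image is a later point that is also moved. -/
theorem fixes_of_eventually_fixes_near {G : Subgroup (Equiv.Perm Circ)}
    (hfree : ∀ g ∈ G, (∀ᶠ x in cofinite, g x = x) → g = 1) (hG : MovesLocally G)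
    {g : Equiv.Perm Circ} (hg : g ∈ G) {x : Circ} {U : Set Circ} (hU : U ∈ 𝓝 x)
    (hgU : ∀ᶠ p in cofinite, p ∈ U → g p = p) : g x = x := by
  obtain ⟨x, rfl⟩ := circ_coe_isOpenQuotientMap.surjective x
  obtain ⟨η, hη, hη2, hηU⟩ := exists_circ_image_Ioo_subset hU
  by_contra hx
  set M : Set ℝ := {y | y ∈ Ioo (x - η) (x + η) ∧ g (y : Circ) ≠ y} with hM
  have hMfin : M.Finite := by
    refine Set.Finite.of_finite_image (f := ((↑) : ℝ → Circ))
      ((eventually_cofinite.1 hgU).subset ?_) ?_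
    · rintro _ ⟨y, hy, rfl⟩ h
      exact hy.2 (h (hηU ⟨y, hy.1, rfl⟩))
    · intro y hy z hz hyz
      exact (AddCircle.coe_eq_coe_iff_of_mem_Ico (p := (1 : ℝ)) (a := x - η)
        ⟨hy.1.1.le, by linarith [hy.1.2]⟩ ⟨hz.1.1.le, by linarith [hz.1.2]⟩).1 hyz
  obtain ⟨y, hyM, hymax⟩ := Set.exists_max_image M id hMfin
    ⟨x, ⟨by linarith, by linarith⟩, hx⟩
  obtain ⟨k, hkG, d, hd0, hdε, hky, hks⟩ := hG y (min (x + η - y) (y - (x - η)))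
    (lt_min (by linarith [hyM.1.2]) (by linarith [hyM.1.1]))
  have hε1 := min_le_left (x + η - y) (y - (x - η))
  have hε2 := min_le_right (x + η - y) (y - (x - η))
  have hZ : {p | g p ≠ p ∧ k p ≠ p}.Finite := by
    have h1 : ∀ᶠ p in cofinite, ¬ (g p ≠ p ∧ k p ≠ p) := by
      filter_upwards [hks, hgU] with p h1 h2 h3
      obtain ⟨z, hz, rfl⟩ := h1 h3.2
      exact h3.1 (h2 (hηU ⟨z, ⟨by linarith [hz.1], by linarith [hz.2]⟩, rfl⟩))
    simpa only [not_not] using eventually_cofinite.1 h1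
  have hcomm : g * k = k * g := by
    rw [← commutatorElement_eq_one_iff_mul_comm]
    refine hfree _ (G.mul_mem (G.mul_mem (G.mul_mem hg hkG) (G.inv_mem hg)) (G.inv_mem hkG)) ?_
    rw [eventually_cofinite]
    exact ((hZ.union (hZ.image g)).union (hZ.image k)).subset (moved_commutator_subset g k)
  have hmem : y + d ∈ M := by
    refine ⟨⟨by linarith [hyM.1.1], by linarith⟩, fun h => hyM.2 ?_⟩
    rw [← hky, ← Equiv.Perm.mul_apply, hcomm, Equiv.Perm.mul_apply] at h
    exact k.injective h
  have := hymax _ hmem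
  simp only [id] at this
  linarith

/-- An element sends each point to one of its one-sided limits there: it conjugates elements that
move `x` and have small support around `x` to elements with support near these limits. -/
theorem apply_eq_or_eq_of_tendsto {G : Subgroup (Equiv.Perm Circ)}
    (hfree : ∀ g ∈ G, (∀ᶠ x in cofinite, g x = x) → g = 1) (hG : MovesLocally G)
    {f : Equiv.Perm Circ} (hf : f ∈ G) {x p q : Circ}
    (hlim : Tendsto f (𝓝[≠] x) (𝓝 p ⊔ 𝓝 q)) : f x = p ∨ f x = q := by
  by_contra! hne
  obtain ⟨y, rfl⟩ := circ_coe_isOpenQuotientMap.surjective x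
  have hdisj : Disjoint (𝓝 (f y)) (𝓝 p ⊔ 𝓝 q) := by
    rw [disjoint_sup_right, disjoint_nhds_nhds, disjoint_nhds_nhds]
    exact hne
  obtain ⟨W, hW, V, hV, hWV⟩ := Filter.disjoint_iff.1 hdisj
  have hfV : insert (y : Circ) (f ⁻¹' V) ∈ 𝓝 (y : Circ) := insert_mem_nhds_iff.2 (hlim hV)
  obtain ⟨ε, hε, hε2, hεV⟩ := exists_circ_image_Ioo_subset hfV
  obtain ⟨k, hkG, d, hd0, hdε, hky, hks⟩ := hG y ε hε
  have hconj : (f * k * f⁻¹) (f y) = f y := by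
    refine fixes_of_eventually_fixes_near hfree hG
      (G.mul_mem (G.mul_mem hf hkG) (G.inv_mem hf)) hW ?_
    have t1 : Tendsto (fun z : Circ => f⁻¹ z) cofinite cofinite :=
      (f⁻¹).injective.tendsto_cofinite
    filter_upwards [t1.eventually hks, (finite_singleton (f (y : Circ))).eventually_cofinite_notMem]
      with z hz hzy hzW
    have e : f (f⁻¹ z) = z := f.apply_symm_apply z
    rw [Equiv.Perm.mul_apply, Equiv.Perm.mul_apply]
    by_contra hmoved
    rcases hεV (hz fun h => hmoved (by rw [h, e])) with h | h
    · exact hzy (by rw [mem_singleton_iff, ← h, e])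
    · rw [mem_preimage, e] at h
      exact Set.disjoint_left.1 hWV hzW h
  have e : f⁻¹ (f (y : Circ)) = y := f.symm_apply_apply _
  rw [Equiv.Perm.mul_apply, Equiv.Perm.mul_apply, e, hky] at hconj
  have h1 := (AddCircle.coe_eq_coe_iff_of_mem_Ico (p := (1 : ℝ)) (a := y)
    ⟨by linarith, by linarith⟩ ⟨le_rfl, by linarith⟩).1 (f.injective hconj)
  linarith

/-! ### Normalizing a realization -/

theorem PC.proj_eq_proj_iff {g h : PCHat} : PC.proj g = PC.proj h ↔
    ∀ᶠ x in cofinite, (g : Equiv.Perm Circ) x = (h : Equiv.Perm Circ) x := by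
  have h1 : PC.proj g = PC.proj h ↔ {x | ((g : Equiv.Perm Circ)⁻¹ * h) x ≠ x}.Finite :=
    QuotientGroup.eq
  rw [h1, ← eventually_cofinite (p := fun x => ((g : Equiv.Perm Circ)⁻¹ * h) x = x)]
  refine eventually_congr (Eventually.of_forall fun x => ?_)
  rw [Equiv.Perm.mul_apply, Equiv.Perm.inv_eq_iff_eq, eq_comm]

/-- A realizable group of piecewise continuous transformations lifts to a group of permutations
without nontrivial finitely supported elements. -/
theorem IsRealizable.exists_lift {Γ : Subgroup PC} (hΓ : IsRealizable Γ) :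
    ∃ G : Subgroup (Equiv.Perm Circ), (∀ g ∈ G, (∀ᶠ x in cofinite, g x = x) → g = 1) ∧
      ∀ g : PCHat, PC.proj g ∈ Γ → ∃ r ∈ G, ∀ᶠ x in cofinite, r x = (g : Equiv.Perm Circ) x := by
  obtain ⟨L, hL⟩ := hΓ
  refine ⟨L.map PCHat.subtype, ?_, ?_⟩
  · rintro _ ⟨g, hg, rfl⟩ hfix
    have h1 : PC.proj g = PC.proj 1 := PC.proj_eq_proj_iff.2 hfix
    rw [hL.injOn hg L.one_mem h1, map_one]
  · intro g hg
    obtain ⟨r, hr, hrg⟩ := hL.surjOn hg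
    exact ⟨r, ⟨r, hr, rfl⟩, PC.proj_eq_proj_iff.1 hrg⟩

/-- The lift can be chosen to contain the rotations themselves, if they form a group with one
end. -/
theorem IsRealizable.exists_lift_with_rotations {Γ : Subgroup PC} (hΓ : IsRealizable Γ)
    (Λ : AddSubgroup Circ) (hΛ : ∀ t ∈ Λ, circRotation t ∈ Γ) {h : Λ}
    (hh : ¬ IsOfFinAddOrder h) (hq : Infinite (Λ ⧸ AddSubgroup.zmultiples h)) :
    ∃ G : Subgroup (Equiv.Perm Circ), (∀ g ∈ G, (∀ᶠ x in cofinite, g x = x) → g = 1) ∧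
      (∀ g : PCHat, PC.proj g ∈ Γ → ∃ r ∈ G, ∀ᶠ x in cofinite, r x = (g : Equiv.Perm Circ) x) ∧
      ∀ t ∈ Λ, Equiv.addRight t ∈ G := by
  obtain ⟨G, hfree, hlift⟩ := hΓ.exists_lift
  have hs : ∀ t : Λ, ∃ r ∈ G, ∀ᶠ x in cofinite, r x = x + (t : Circ) := fun t =>
    hlift _ (hΛ t t.2)
  choose s hsG hs using hs
  have hadd : ∀ t u, s (t + u) = s t * s u := by
    intro t u
    rw [← inv_mul_eq_one]
    refine hfree _ (G.mul_mem (G.inv_mem (hsG _)) (G.mul_mem (hsG _) (hsG _))) ?_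
    have t1 : Tendsto (fun x : Circ => s u x) cofinite cofinite :=
      (s u).injective.tendsto_cofinite
    filter_upwards [hs u, t1.eventually (hs t), hs (t + u)] with x h1 h2 h3
    rw [Equiv.Perm.mul_apply, Equiv.Perm.inv_eq_iff_eq, Equiv.Perm.mul_apply, h2, h1, h3]
    push_cast; abel
  obtain ⟨f, hfix, hf⟩ := exists_finPerm_conj_translations Λ hh hq s hadd hs
  refine ⟨G.map (MulAut.conj f⁻¹).toMonoidHom, ?_, ?_, ?_⟩
  · rintro _ ⟨g, hg, rfl⟩ hgfix
    have h1 : g = 1 := by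
      refine hfree g hg ?_
      have t1 : Tendsto (fun x : Circ => f⁻¹ x) cofinite cofinite :=
        (f⁻¹).injective.tendsto_cofinite
      filter_upwards [t1.eventually hgfix] with x hx
      have e : f (f⁻¹ x) = x := f.apply_symm_apply x
      have h2 : f⁻¹ (g (f (f⁻¹ x))) = f⁻¹ x := by simpa using hx
      rw [e] at h2
      exact (f⁻¹).injective h2
    rw [h1, map_one]
  · intro g hg
    obtain ⟨r, hrG, hr⟩ := hlift g hg
    refine ⟨_, ⟨r, hrG, rfl⟩, ?_⟩
    have t1 : Tendsto (fun x : Circ => (g : Equiv.Perm Circ) x) cofinite cofinite :=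
      (g : Equiv.Perm Circ).injective.tendsto_cofinite
    filter_upwards [hr, hfix, t1.eventually hfix] with x h1 h2 h3
    have h4 : f⁻¹ (r (f x)) = (g : Equiv.Perm Circ) x := by
      rw [h2, h1, Equiv.Perm.inv_eq_iff_eq, h3]
    simpa using h4
  · intro t ht
    refine ⟨s ⟨t, ht⟩, hsG _, ?_⟩
    rw [← hf ⟨t, ht⟩]
    simp

/-! ### Flips -/

theorem tendsto_of_strictMonoOn_image_Ioo {φ : ℝ → ℝ} {a b c d : ℝ} (hab : a < b)
    (hφ : StrictMonoOn φ (Ioo a b)) (him : φ '' Ioo a b = Ioo c d) :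
    Tendsto φ (𝓝[>] a) (𝓝 c) ∧ Tendsto φ (𝓝[<] b) (𝓝 d) := by
  have hcd : c < d := nonempty_Ioo.1 (him ▸ (nonempty_Ioo.2 hab).image φ)
  have h1 := hφ.monotoneOn.tendsto_nhdsWithin_Ioo_right (nonempty_Ioo.2 hab)
    (by rw [him]; exact bddBelow_Ioo)
  have h2 := hφ.monotoneOn.tendsto_nhdsWithin_Ioo_left (nonempty_Ioo.2 hab)
    (by rw [him]; exact bddAbove_Ioo)
  rw [him, csInf_Ioo hcd] at h1
  rw [him, csSup_Ioo hcd] at h2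
  exact ⟨h1, h2⟩

theorem MapsArcPreserving.tendsto {g : PCHat} {a b c d : ℝ} (h : MapsArcPreserving g a b c d)
    (hab : a < b) :
    Tendsto (fun x : ℝ => (g : Equiv.Perm Circ) (x : Circ)) (𝓝[>] a) (𝓝 (c : Circ)) ∧
      Tendsto (fun x : ℝ => (g : Equiv.Perm Circ) (x : Circ)) (𝓝[<] b) (𝓝 (d : Circ)) := by
  obtain ⟨φ, hφ, him, hg⟩ := h
  obtain ⟨h1, h2⟩ := tendsto_of_strictMonoOn_image_Ioo hab hφ him
  have hcoe := circ_coe_isOpenQuotientMap.continuous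
  constructor
  · refine ((hcoe.tendsto c).comp h1).congr' ?_
    filter_upwards [Ioo_mem_nhdsGT hab] with x hx using (hg x hx).symm
  · refine ((hcoe.tendsto d).comp h2).congr' ?_
    filter_upwards [Ioo_mem_nhdsLT hab] with x hx using (hg x hx).symm

theorem MapsArcReversing.tendsto {g : PCHat} {a b c d : ℝ} (h : MapsArcReversing g a b c d)
    (hab : a < b) :
    Tendsto (fun x : ℝ => (g : Equiv.Perm Circ) (x : Circ)) (𝓝[>] a) (𝓝 (d : Circ)) ∧
      Tendsto (fun x : ℝ => (g : Equiv.Perm Circ) (x : Circ)) (𝓝[<] b) (𝓝 (c : Circ)) := by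
  obtain ⟨φ, hφ, him, hg⟩ := h
  have himneg : (fun x => -φ x) '' Ioo a b = Ioo (-d) (-c) := by
    rw [← image_neg_Ioo, ← him, image_image]
  obtain ⟨h1, h2⟩ := tendsto_of_strictMonoOn_image_Ioo hab hφ.neg himneg
  have h1' : Tendsto φ (𝓝[>] a) (𝓝 d) := by simpa using h1.neg
  have h2' : Tendsto φ (𝓝[<] b) (𝓝 c) := by simpa using h2.neg
  have hcoe := circ_coe_isOpenQuotientMap.continuous
  constructor
  · refine ((hcoe.tendsto d).comp h1').congr' ?_
    filter_upwards [Ioo_mem_nhdsGT hab] with x hx using (hg x hx).symm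
  · refine ((hcoe.tendsto c).comp h2').congr' ?_
    filter_upwards [Ioo_mem_nhdsLT hab] with x hx using (hg x hx).symm

theorem tendsto_nhdsNE_of_one_sided {f g : Circ → Circ} (hfg : ∀ᶠ x in cofinite, f x = g x)
    {x : ℝ} {p q : Circ} (hl : Tendsto (fun y : ℝ => g (y : Circ)) (𝓝[<] x) (𝓝 p))
    (hr : Tendsto (fun y : ℝ => g (y : Circ)) (𝓝[>] x) (𝓝 q)) :
    Tendsto f (𝓝[≠] (x : Circ)) (𝓝 p ⊔ 𝓝 q) := by
  have h1 : Tendsto (fun y : ℝ => g (y : Circ)) (𝓝[≠] x) (𝓝 p ⊔ 𝓝 q) := by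
    rw [← nhdsLT_sup_nhdsGT]
    exact hl.sup_sup hr
  have h2 : 𝓝[≠] (x : Circ) ≤ map ((↑) : ℝ → Circ) (𝓝[≠] x) := by
    intro S hS
    have h3 : insert x (((↑) : ℝ → Circ) ⁻¹' S) ∈ 𝓝 x := insert_mem_nhds_iff.2 hS
    refine insert_mem_nhds_iff.1 (mem_of_superset
      (circ_coe_isOpenQuotientMap.isOpenMap.image_mem_nhds h3) ?_)
    rintro _ ⟨y, rfl | hy, rfl⟩
    · exact mem_insert _ _
    · exact mem_insert_of_mem _ hy
  have h4 : Tendsto g (𝓝[≠] (x : Circ)) (𝓝 p ⊔ 𝓝 q) := (tendsto_map'_iff.2 h1).mono_left h2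
  refine h4.congr' ?_
  filter_upwards [nhdsNE_le_cofinite _ hfg] with y hy using hy.symm

/-- At each of the three endpoints of the arcs of a 132-flip or of a triple flip, the two one-sided
limits of the flip are the two other endpoints. The map is only prescribed up to finitely many
points, so that the lemma applies to every lift of the flip. -/
theorem exists_singular_points_of_flip {f : PC} (hf : IsFlip132 f ∨ IsTripleFlip f) :
    ∃ a b c : Circ, a ≠ b ∧ b ≠ c ∧ a ≠ c ∧ ∃ g : PCHat, PC.proj g = f ∧
      ∀ F : Circ → Circ, (∀ᶠ x in cofinite, F x = (g : Equiv.Perm Circ) x) →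
        Tendsto F (𝓝[≠] a) (𝓝 b ⊔ 𝓝 c) ∧ Tendsto F (𝓝[≠] b) (𝓝 a ⊔ 𝓝 c) ∧
          Tendsto F (𝓝[≠] c) (𝓝 a ⊔ 𝓝 b) := by
  have hne : ∀ {x y z : ℝ}, x < y → y < z → z < x + 1 →
      (x : Circ) ≠ y ∧ (y : Circ) ≠ z ∧ (x : Circ) ≠ z := by
    intro x y z hxy hyz hzx
    refine ⟨fun h => ?_, fun h => ?_, fun h => ?_⟩
    all_goals
      have := (AddCircle.coe_eq_coe_iff_of_mem_Ico (p := (1 : ℝ)) (a := x)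
        ⟨by linarith, by linarith⟩ ⟨by linarith, by linarith⟩).1 h
      linarith
  rcases hf with ⟨-, a, b, c, hab, hbc, hca, g, hg, h1, h2, h3⟩ |
    ⟨-, a, b, c, hab, hbc, hca, g, hg, h1, h2, h3⟩
  all_goals
    obtain ⟨n1, n2, n3⟩ := hne hab hbc hca
    refine ⟨a, b, c, n1, n2, n3, g, hg, fun F hF => ?_⟩
    obtain ⟨r1, l1⟩ := h1.tendsto hab
    obtain ⟨r2, l2⟩ := h2.tendsto hbc
    obtain ⟨r3, l3⟩ := h3.tendsto hca
    -- the arc on the left of `a` ends at the representative `a + 1` of `a`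
    have l3' : Tendsto (fun y : ℝ => (g : Equiv.Perm Circ) (y : Circ)) (𝓝[<] a) (𝓝 (c : Circ)) := by
      have hshift : Tendsto (fun y : ℝ => y + 1) (𝓝[<] a) (𝓝[<] (a + 1)) := by
        refine tendsto_nhdsWithin_of_tendsto_nhds_of_eventually_within _
          ((tendsto_id.add_const 1).mono_left nhdsWithin_le_nhds) ?_
        filter_upwards [self_mem_nhdsWithin] with y hy
        exact add_lt_add_left (mem_Iio.1 hy) 1
      refine (l3.comp hshift).congr fun y => ?_
      rw [Function.comp_apply, circ_coe_add_one]
    have ha := tendsto_nhdsNE_of_one_sided hF l3' r1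
    have hb := tendsto_nhdsNE_of_one_sided hF l1 r2
    have hc := tendsto_nhdsNE_of_one_sided hF l2 r3
    rw [circ_coe_add_one] at hc
    refine ⟨by rwa [sup_comm], hb, ?_⟩
    first
      | exact hc
      | rwa [sup_comm]

/-- A map that permutes three points without fixing any of them is not an involution. -/
theorem not_involutive_of_three_points {X : Type*} {f : X → X} (hf : Function.Involutive f)
    {a b c : X} (hab : a ≠ b) (hbc : b ≠ c) (hac : a ≠ c) (ha : f a = b ∨ f a = c)
    (hb : f b = a ∨ f b = c) (hc : f c = a ∨ f c = b) : False := by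
  have haa := hf a
  have hbb := hf b
  have hcc := hf c
  grind

theorem mainTheorem2 (Γ : Subgroup PC)
    (hrot : ∃ Λ : AddSubgroup Circ, (∀ t ∈ Λ, circRotation t ∈ Γ) ∧
      (2 ≤ qRank Λ ∨ (¬ Λ.FG ∧ qRank Λ = 1)))
    (hpartial : ∃ (a ρ : ℝ) (h₀ : 0 < ρ) (h₁ : ρ < 1) (D : AddSubgroup (AddCircle ρ)),
      Dense (D : Set (AddCircle ρ)) ∧ ∀ t ∈ D, partialRotation a ρ h₀ h₁ t ∈ Γ)
    (hflip : ∃ f ∈ Γ, IsFlip132 f ∨ IsTripleFlip f) :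
    ¬ IsRealizable Γ := by
  intro hΓ
  obtain ⟨Λ, hΛΓ, hΛ⟩ := hrot
  obtain ⟨a₀, ρ, h₀, h₁, D, hD, hDΓ⟩ := hpartial
  obtain ⟨f, hfΓ, hf⟩ := hflip
  obtain ⟨h, hh, hq⟩ := exists_infinite_quotient_of_qRank (A := Λ)
    (hΛ.imp_right fun H => ⟨fun hFG => H.1 ((AddGroup.fg_iff_addSubgroup_fg Λ).1 hFG), H.2⟩)
  obtain ⟨G, hfree, hlift, hrotG⟩ := hΓ.exists_lift_with_rotations Λ hΛΓ hh hq
  have hΛdense : Dense (Λ : Set Circ) := by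
    have h2 : addOrderOf (h : Circ) = 0 := by
      rw [AddSubgroup.addOrderOf_coe]
      exact addOrderOf_eq_zero_iff.2 hh
    refine (AddCircle.denseRange_zsmul_iff.2 h2).mono ?_
    rintro _ ⟨n, rfl⟩
    exact Λ.zsmul_mem h.2 n
  have hG : MovesLocally G := movesLocally_of_rotations hΛdense hrotG h₀ h₁ hD fun t ht =>
    hlift ⟨_, partialRotationPerm_mem a₀ ρ h₀ h₁ t⟩ (hDΓ t ht)
  obtain ⟨a, b, c, hab, hbc, hac, g, hg, hlim⟩ := exists_singular_points_of_flip hf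
  obtain ⟨F, hFG, hF⟩ := hlift g (hg ▸ hfΓ)
  obtain ⟨ha, hb, hc⟩ := hlim F hF
  have hinv : Function.Involutive F := by
    have hf2 : f ^ 2 = 1 := hf.elim (·.1) (·.1)
    have hg2 : PC.proj (g * g) = PC.proj 1 := by rw [map_mul, map_one, hg, ← pow_two, hf2]
    have hF2 : F * F = 1 := by
      refine hfree _ (G.mul_mem hFG hFG) ?_
      have t1 : Tendsto (fun x : Circ => F x) cofinite cofinite := F.injective.tendsto_cofinite
      filter_upwards [PC.proj_eq_proj_iff.1 hg2, hF, t1.eventually hF] with x h1 h2 h3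
      rw [Equiv.Perm.mul_apply, h3, h2]
      exact h1
    intro x
    rw [← Equiv.Perm.mul_apply, hF2, Equiv.Perm.one_apply]
  exact not_involutive_of_three_points hinv hab hbc hac
    (apply_eq_or_eq_of_tendsto hfree hG hFG ha) (apply_eq_or_eq_of_tendsto hfree hG hFG hb)
    (apply_eq_or_eq_of_tendsto hfree hG hFG hc)
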